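/- Let $q\ge 2$. Let $T$ be the $(q+1)$-regular tree in which every vertex has one predecessor (below it) and $q$ successors (above it), the edges from a vertex to its successors being labelled bijectively by $\{0,\dots,q-1\}$; fix a base vertex $o$ such that all edges on the descending ray from $o$ are labelled $0$. For a vertex $v$, let $o\curlywedge v$ be the greatest common ancestor of $o$ and $v$, and put $m(v)=d_T(o,o\curlywedge v)$, $l(v)=d_T(v,o\curlywedge v)$ and $h(v)=l(v)-m(v)$. The Diestel–Leader graph $DL_3(q)$ has as vertices the triples $(v_1,v_2,v_3)$ of vertices of $T$ with $h(v_1)+h(v_2)+h(v_3)=0$; two vertices $v,w$ are adjacent if there are $i\ne j$ such that $v_i,w_i$ are adjacent in $T$, $v_j,w_j$ are adjacent in $T$, and $v_k=w_k$ for the remaining index $k$. Let $X$ be its vertex set with the graph metric $d$ (edges of length $1$) and base point $id=(o,o,o)$. For $x\in X$ let $f_x(z)=d(x,z)-d(x,id)$. Let $\overline X$ be the closure of $\{f_x : x\in X\}$ in the space of continuous functions $X\to\mathbb R$ vanishing at $id$, with the compact-open topology, identify $X$ with $\{f_x\}$, and let $\partial DL_3(q)=\overline X\setminus X$ be the horofunction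 boundary. For $W\subseteq X$ and $C\ge 0$ let $H(W,C)=\{z\in X : d(z,W)\le d(z,id)+C\}$, and for $\xi\in\partial DL_3(q)$ define its star by $$S(\xi)=\overline{\bigcup_{C\ge 0}\ \bigcap_{U}\ \overline{H(U\cap X,C)}},$$ where $U$ runs over the neighbourhoods of $\xi$ in $\overline X$ and closures are taken in $\overline X$. For $n\ge 0$ let $\beta_n\in X$ be the vertex whose first two coordinates are $o$ and whose third coordinate is reached from $o$ by going down $n$ edges and then up $n$ edges, all labelled $1$. Then the sequence $(\beta_n)$ defines a horofunction $\beta$, that is, the limit $\beta(z)=\lim_{n\to\infty}\bigl(d(\beta_n,z)-d(\beta_n,id)\bigr)$ exists for every $z\in X$; moreover $\beta\in\partial DL_3(q)$, and $\beta$ is an isolated point of $\partial DL_3(q)$. Even so, $S(\beta)\ne\{\beta\}$. -/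

import Mathlib

open Set Filter Topology

/-! ### The regular tree of valence `q + 1`, with a chosen end -/

/-- Vertices of the `(q+1)`-regular tree `T` in which every vertex has one predecessor and `q`
successors labelled by `Fin q`, with base vertex `o`; the edges on the descending ray from `o`
carry the label `0`. A vertex `v` is recorded by the geodesic from `o` to it: go down `down` edges
to `o ⋏ v`, the greatest common ancestor of `o` and `v`, then follow upwards the edges whose labels
are listed in `up`, without backtracking.
Thus `m(v) = d(o, o ⋏ v) = down` and `l(v) = d(v, o ⋏ v) = up.length`. -/
@[ext]
structure TreeVertex (q : ℕ) where
  down : ℕ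
  up : List (Fin q)
  noBacktrack : 0 < down → ∀ a ∈ up.head?, (a : ℕ) ≠ 0

namespace TreeVertex

variable {q : ℕ}

/-- The base vertex `o`. -/
def base (q : ℕ) : TreeVertex q := ⟨0, [], by simp⟩

/-- The height `h(v) = l(v) - m(v)`. -/
def height (v : TreeVertex q) : ℤ := (v.up.length : ℤ) - (v.down : ℤ)

/-- The predecessor of a vertex: one edge downwards. -/
def pred (v : TreeVertex q) : TreeVertex q :=
  if v.up = [] then ⟨v.down + 1, [], by simp⟩
  else ⟨v.down, v.up.dropLast, fun h a ha => v.noBacktrack h a (by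
    have ha' : v.up.dropLast.head? = some a := ha
    rw [List.head?_dropLast] at ha'
    split_ifs at ha'
    exact ha')⟩

lemma height_pred (v : TreeVertex q) : v.pred.height = v.height - 1 := by
  unfold pred height
  split_ifs with h
  · simp [h]; ring
  · have : 0 < v.up.length := List.length_pos_iff.2 h
    simp only [List.length_dropLast]
    omega

lemma pred_ne (v : TreeVertex q) : v.pred ≠ v := by
  intro h
  have h1 := v.height_pred
  rw [h] at h1
  omega

/-- The tree `T`: each vertex is joined to its predecessor. -/
def graph (q : ℕ) : SimpleGraph (TreeVertex q) where
  Adj v w := v.pred = w ∨ w.pred = v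
  symm := ⟨fun _ _ h => h.symm⟩
  loopless := ⟨fun v h => h.elim v.pred_ne v.pred_ne⟩

/-- The successor of `v` along the edge labelled `1`. -/
def succOne [hq : Fact (2 ≤ q)] (v : TreeVertex q) : TreeVertex q :=
  ⟨v.down, v.up ++ [⟨1, hq.out⟩], fun h a ha => by
    rcases hv : v.up with _ | ⟨b, l⟩
    · simp only [hv, List.nil_append, List.head?_cons, Option.mem_def, Option.some.injEq] at ha
      simp [← ha]
    · exact v.noBacktrack h a (by simpa [hv] using ha)⟩

lemma pred_succOne [Fact (2 ≤ q)] (v : TreeVertex q) : v.succOne.pred = v := by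
  simp [pred, succOne]

lemma iterate_pred_base (n : ℕ) : pred^[n] (base q) = ⟨n, [], by simp⟩ := by
  induction n with
  | zero => rfl
  | succ n ih => rw [Function.iterate_succ_apply', ih]; simp [pred]

lemma iterate_pred_length (v : TreeVertex q) : pred^[v.up.length] v = ⟨v.down, [], by simp⟩ := by
  induction hn : v.up.length generalizing v with
  | zero =>
    have : v.up = [] := List.length_eq_zero_iff.1 hn
    ext <;> simp [this]
  | succ n ih =>
    have hv : v.up ≠ [] := by
      intro h
      simp [h] at hn
    rw [Function.iterate_succ_apply, ih]
    · ext <;> simp [pred, hv]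
    · simp [pred, hv, hn]

lemma reachable_iterate_pred (n : ℕ) (v : TreeVertex q) :
    (graph q).Reachable v (pred^[n] v) := by
  induction n with
  | zero => exact SimpleGraph.Reachable.refl v
  | succ n ih =>
    rw [Function.iterate_succ_apply']
    refine ih.trans (SimpleGraph.Adj.reachable ?_)
    exact Or.inl rfl

lemma reachable_base (v : TreeVertex q) : (graph q).Reachable v (base q) := by
  have h1 := reachable_iterate_pred v.up.length v
  have h2 := reachable_iterate_pred v.down (base q)
  rw [iterate_pred_length] at h1
  rw [iterate_pred_base] at h2
  exact h1.trans h2.symm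

end TreeVertex

/-! ### The Diestel-Leader graph -/

/-- Vertices of `DL_d(q)`: `d`-tuples of vertices of the tree whose heights sum to zero. -/
@[ext]
structure DL (d q : ℕ) where
  coord : Fin d → TreeVertex q
  sum_height : ∑ i, (coord i).height = 0

namespace DL

variable {d q : ℕ}

/-- The base vertex `id = (o, …, o)`. -/
def base (d q : ℕ) : DL d q := ⟨fun _ => TreeVertex.base q, by
  simp [TreeVertex.height, TreeVertex.base]⟩

/-- Two vertices are adjacent if they differ by an edge in exactly two of the trees. -/
def graph (d q : ℕ) : SimpleGraph (DL d q) where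
  Adj v w := ∃ i j, i ≠ j ∧ (TreeVertex.graph q).Adj (v.coord i) (w.coord i) ∧
    (TreeVertex.graph q).Adj (v.coord j) (w.coord j) ∧
    ∀ k, k ≠ i → k ≠ j → v.coord k = w.coord k
  symm := ⟨fun _ _ ⟨i, j, hij, hi, hj, h⟩ =>
    ⟨i, j, hij, hi.symm, hj.symm, fun k hk hk' => (h k hk hk').symm⟩⟩
  loopless := ⟨fun _ ⟨_, _, _, hi, _⟩ => hi.ne rfl⟩

lemma exists_adj (v : DL d q) {i j : Fin d} (hij : i ≠ j) {a b : TreeVertex q}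
    (ha : (TreeVertex.graph q).Adj (v.coord i) a) (hb : (TreeVertex.graph q).Adj (v.coord j) b)
    (h : a.height + b.height = (v.coord i).height + (v.coord j).height) :
    ∃ u : DL d q, (graph d q).Adj v u ∧ u.coord i = a ∧ u.coord j = b ∧
      ∀ k, k ≠ i → k ≠ j → u.coord k = v.coord k := by
  classical
  refine ⟨⟨Function.update (Function.update v.coord i a) j b, ?_⟩,
    ⟨i, j, hij, ?_, ?_, ?_⟩, ?_, ?_, ?_⟩
  · rw [← v.sum_height, ← sub_eq_zero, ← Finset.sum_sub_distrib, Fintype.sum_eq_add i j hij]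
    · simp only [Function.update_of_ne hij, Function.update_self]
      linarith
    · rintro k ⟨hki, hkj⟩
      simp [Function.update_of_ne hki, Function.update_of_ne hkj]
  · simpa [Function.update_of_ne hij] using ha
  · simpa using hb
  · intro k hki hkj
    simp [Function.update_of_ne hki, Function.update_of_ne hkj]
  · simp [Function.update_of_ne hij]
  · simp
  · intro k hki hkj
    simp [Function.update_of_ne hki, Function.update_of_ne hkj]

lemma exists_reachable [Fact (2 ≤ q)] (v : DL d q) {i j : Fin d} (hij : i ≠ j)
    {s t : TreeVertex q} (h : (TreeVertex.graph q).Reachable s t) (hs : v.coord i = s) :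
    ∃ u : DL d q, (graph d q).Reachable v u ∧ u.coord i = t ∧
      ∀ k, k ≠ i → k ≠ j → u.coord k = v.coord k := by
  obtain ⟨p⟩ := h
  induction p generalizing v with
  | nil => exact ⟨v, SimpleGraph.Reachable.refl v, hs, fun _ _ _ => rfl⟩
  | @cons s r t hsr p ih =>
    obtain ⟨b, hb, hh⟩ : ∃ b, (TreeVertex.graph q).Adj (v.coord j) b ∧
        r.height + b.height = (v.coord i).height + (v.coord j).height := by
      rcases hsr with h | h
      · refine ⟨(v.coord j).succOne, Or.inr (TreeVertex.pred_succOne _), ?_⟩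
        have h1 := s.height_pred
        have h2 := (v.coord j).succOne.height_pred
        rw [TreeVertex.pred_succOne] at h2
        rw [← h, hs]
        linarith
      · refine ⟨(v.coord j).pred, Or.inl rfl, ?_⟩
        have h1 := r.height_pred
        have h2 := (v.coord j).height_pred
        rw [h] at h1
        rw [hs]
        linarith
    obtain ⟨u, hvu, hui, -, huk⟩ := v.exists_adj hij (hs ▸ hsr) hb hh
    obtain ⟨w, huw, hwi, hwk⟩ := ih u hui
    exact ⟨w, hvu.reachable.trans huw, hwi, fun k h1 h2 => (hwk k h1 h2).trans (huk k h1 h2)⟩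

lemma exists_reachable_iterate [Fact (2 ≤ q)] (n : ℕ) (v : DL 3 q) :
    ∃ u : DL 3 q, (graph 3 q).Reachable v u ∧ u.coord 0 = TreeVertex.succOne^[n] (v.coord 0) ∧
      u.coord 1 = v.coord 1 ∧ u.coord 2 = TreeVertex.pred^[n] (v.coord 2) := by
  induction n with
  | zero => exact ⟨v, SimpleGraph.Reachable.refl v, rfl, rfl, rfl⟩
  | succ n ih =>
    obtain ⟨u, hvu, h0, h1, h2⟩ := ih
    have e1 := (u.coord 2).height_pred
    have e2 := (u.coord 0).succOne.height_pred
    rw [TreeVertex.pred_succOne] at e2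
    obtain ⟨w, huw, w0, w2, wk⟩ := u.exists_adj (i := 0) (j := 2) (by decide)
      (a := (u.coord 0).succOne) (b := (u.coord 2).pred)
      (Or.inr (TreeVertex.pred_succOne _)) (Or.inl rfl) (by linarith)
    refine ⟨w, hvu.trans huw.reachable, ?_, ?_, ?_⟩
    · rw [w0, h0, Function.iterate_succ_apply']
    · rw [wk 1 (by decide) (by decide), h1]
    · rw [w2, h2, Function.iterate_succ_apply']

lemma connected (q : ℕ) [Fact (2 ≤ q)] : (graph 3 q).Connected := by
  suffices h : ∀ v : DL 3 q, (graph 3 q).Reachable v (base 3 q) by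
    have : Nonempty (DL 3 q) := ⟨base 3 q⟩
    exact SimpleGraph.Connected.mk fun v w => (h v).trans (h w).symm
  intro v
  obtain ⟨u, hvu, u0, -⟩ := v.exists_reachable (i := 0) (j := 2) (by decide)
    (TreeVertex.reachable_base _) rfl
  obtain ⟨w, huw, w1, wk⟩ := u.exists_reachable (i := 1) (j := 2) (by decide)
    (TreeVertex.reachable_base _) rfl
  have w0 : w.coord 0 = TreeVertex.base q := (wk 0 (by decide) (by decide)).trans u0
  have hlen : (w.coord 2).up.length = (w.coord 2).down := by
    have h := w.sum_height
    rw [Fin.sum_univ_three, w0, w1] at h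
    simp [TreeVertex.height, TreeVertex.base] at h
    omega
  obtain ⟨x, hwx, x0, x1, x2⟩ := w.exists_reachable_iterate (w.coord 2).up.length
  obtain ⟨y, hby, y0, y1, y2⟩ := (base 3 q).exists_reachable_iterate (w.coord 2).up.length
  have hxy : x = y := by
    ext1
    funext k
    fin_cases k
    · exact x0.trans ((by rw [w0]; rfl : _ = _).trans y0.symm)
    · exact x1.trans (w1.trans y1.symm)
    · refine x2.trans (Eq.trans ?_ y2.symm)
      rw [TreeVertex.iterate_pred_length]
      change _ = TreeVertex.pred^[_] (TreeVertex.base q)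
      rw [TreeVertex.iterate_pred_base]
      exact TreeVertex.ext hlen.symm rfl
  subst hxy
  exact hvu.trans (huw.trans (hwx.trans hby.symm))

/-- The vertex set of `DL_3(q)` with the path metric of the graph (all edges of length `1`). -/
noncomputable instance instMetricSpace (q : ℕ) [Fact (2 ≤ q)] : MetricSpace (DL 3 q) where
  dist v w := ((graph 3 q).dist v w : ℝ)
  dist_self v := by simp
  dist_comm v w := by rw [SimpleGraph.dist_comm]
  dist_triangle u v w := by exact_mod_cast (connected q).dist_triangle
  eq_of_dist_eq_zero {v w} h := by
    have h' : (graph 3 q).dist v w = 0 := by exact_mod_cast h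
    exact (connected q).dist_eq_zero_iff.1 h'

/-- The vertex `β_n`: trivial in the first two trees; in the third tree go down `n` edges from
the base vertex, then up `n` edges, all labelled `1`. -/
def betaSeq (q : ℕ) [hq : Fact (2 ≤ q)] (n : ℕ) : DL 3 q where
  coord := ![TreeVertex.base q, TreeVertex.base q,
    ⟨n, List.replicate n ⟨1, hq.out⟩, fun hn a ha => by
      rw [List.head?_replicate, if_neg hn.ne'] at ha
      simp only [Option.mem_def, Option.some.injEq] at ha
      simp [← ha]⟩]
  sum_height := by simp [Fin.sum_univ_three, TreeVertex.height, TreeVertex.base]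

end DL

/-! ### The horofunction boundary and stars at infinity of a based metric space -/

section Horo

variable {X : Type*} [MetricSpace X]

/-- The map `x ↦ f_x`, `f_x(z) = d(x, z) - d(x, x₀)`, into the space of continuous functions with
the compact-open topology. -/
def horoMap (x₀ x : X) : C(X, ℝ) where
  toFun z := dist x z - dist x x₀
  continuous_toFun := by fun_prop

/-- The horofunction bordification: the closure of the image of `X`. (All functions
in it vanish at `x₀`, as this is a closed condition.) -/
def horoClosure (x₀ : X) : Set C(X, ℝ) := closure (range (horoMap x₀))

/-- The horofunction boundary `∂X`. -/
def horoBoundary (x₀ : X) : Set C(X, ℝ) := horoClosure x₀ \ range (horoMap x₀)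

/-- `f` is the horofunction defined by the sequence `x`. -/
def IsHorofunctionOf (x₀ : X) (x : ℕ → X) (f : C(X, ℝ)) : Prop :=
  ∀ z, Tendsto (fun n => dist (x n) z - dist (x n) x₀) atTop (𝓝 (f z))

/-- The halfspace `H(W, C) = {z | d(z, W) ≤ d(z, x₀) + C}`. -/
def halfspace (x₀ : X) (W : Set X) (C : ℝ) : Set X :=
  {z | Metric.infEDist z W ≤ ENNReal.ofReal (dist z x₀ + C)}

/-- The star `S(ξ)` of a point `ξ` of the horofunction boundary. Neighbourhoods `U` of `ξ` enter
through the set of points of `X` that lie in them; closures may be taken in the whole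
function space because the bordification is closed in it. -/
def horoStar (x₀ : X) (ξ : C(X, ℝ)) : Set C(X, ℝ) :=
  closure (⋃ C : ℝ, ⋃ _ : 0 ≤ C, ⋂ U ∈ 𝓝 ξ,
    closure (horoMap x₀ '' halfspace x₀ (horoMap x₀ ⁻¹' U) C))

end Horo

/-! Everything rests on a distance formula (`dist_le_iff`). For vertices $v,w$ let $m_i$, $l_i$ be
the numbers of edges from $v_i$, $w_i$ down to their common ancestor. Then $d(v,w)$ is the minimum,
over the orders $(i,j,k)$ of the trees, of $m_i+l_k+\max(m_i+m_j+m_k,\;m_j+l_j)$.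

Call $(o,o,x_3)$ hanging at depth $n$ if $x_3$ is reached from $o$ by $n$ edges down and $n$ up.
Seen from a fixed $z$ and for large $n$, all such vertices have the same descents, and $d(z,x)-2n$
is constant (`dist_hanging`). So every sequence of hanging vertices with $n\to\infty$ converges to
the same $\beta$, and $\beta$ is unbounded below, hence not some $f_x$.

Isolation: finitely many evaluations force $x$ to be hanging when $f_x$ is near $\beta$
(`exists_isOpen_beta_mem`). Positivity at the two siblings of the base point says that $x_1,x_2$ lie
above $o$; a gain of $2$ on moving up in both of these trees, away from $x$, says that $x_1=x_2=o$.
Each depth has finitely many hanging vertices, so $\beta$ is the only boundary point nearby.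

Star: the vertex that is $k$ edges up in the second tree and $k$ down in the third is at distance
$k$ from $id$ and at most $k$ from $\beta_k$, so it lies in the halfspaces with $C=0$. These
vertices converge to a horofunction that differs from $\beta$ one step up the first tree. -/

namespace TreeVertex

variable {q : ℕ}

/-! ### Descents to common ancestors in the tree -/

lemma height_iterate_pred (n : ℕ) (v : TreeVertex q) : (pred^[n] v).height = v.height - n := by
  induction n with
  | zero => simp
  | succ n ih => rw [Function.iterate_succ_apply', height_pred, ih]; push_cast; ring

lemma exists_iterate_pred_eq (v w : TreeVertex q) : ∃ a b, pred^[a] v = pred^[b] w := by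
  have key : ∀ u : TreeVertex q, pred^[u.up.length] u = pred^[u.down] (base q) := fun u => by
    rw [iterate_pred_length, iterate_pred_base]
  -- Both sides become the vertex `v.down + w.down` edges below $o$ on the descending ray.
  refine ⟨w.down + v.up.length, v.down + w.up.length, ?_⟩
  rw [Function.iterate_add_apply, Function.iterate_add_apply, key, key,
    ← Function.iterate_add_apply, ← Function.iterate_add_apply, add_comm]

open Classical in
/-- The number of edges from `v` down to the greatest common ancestor of `v` and `w`. -/
noncomputable def descent (v w : TreeVertex q) : ℕ := Nat.find (exists_iterate_pred_eq v w)

lemma descent_le {v w : TreeVertex q} {a b : ℕ} (h : pred^[a] v = pred^[b] w) :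
    descent v w ≤ a := by
  classical
  exact Nat.find_min' _ ⟨b, h⟩

lemma sub_eq_of_iterate_pred_eq {v w : TreeVertex q} {a b : ℕ} (h : pred^[a] v = pred^[b] w) :
    (a : ℤ) - b = v.height - w.height := by
  have := congrArg height h
  rw [height_iterate_pred, height_iterate_pred] at this
  linarith

/-- Heights fix the difference of the two exponents at any meeting point, so both are minimal at the
same one. -/
lemma iterate_pred_descent (v w : TreeVertex q) :
    pred^[descent v w] v = pred^[descent w v] w := by
  classical
  have h1 : ∃ b, pred^[descent v w] v = pred^[b] w := Nat.find_spec (exists_iterate_pred_eq v w)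
  have h2 : ∃ b, pred^[descent w v] w = pred^[b] v := Nat.find_spec (exists_iterate_pred_eq w v)
  obtain ⟨b, hb⟩ := h1
  obtain ⟨b', hb'⟩ := h2
  have e1 := sub_eq_of_iterate_pred_eq hb
  have e2 := sub_eq_of_iterate_pred_eq hb'
  have l1 := descent_le hb.symm
  have l2 := descent_le hb'.symm
  have : descent w v = b := by omega
  rw [hb, this]

lemma descent_sub_descent (v w : TreeVertex q) :
    (descent v w : ℤ) - descent w v = v.height - w.height :=
  sub_eq_of_iterate_pred_eq (iterate_pred_descent v w)

lemma eq_of_descent_eq_zero {v w : TreeVertex q} (h : descent v w = 0) (h' : descent w v = 0) :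
    v = w := by
  have := iterate_pred_descent v w
  rwa [h, h'] at this

@[simp] lemma descent_self (v : TreeVertex q) : descent v v = 0 :=
  Nat.le_zero.1 (descent_le (a := 0) (b := 0) rfl)

/-- The effect of moving `v` one edge downwards on the pair of descents. -/
lemma descent_pred (v w : TreeVertex q) :
    (descent v w = descent v.pred w + 1 ∧ descent w v.pred = descent w v) ∨
      (descent v w = 0 ∧ descent v.pred w = 0 ∧ descent w v.pred = descent w v + 1) := by
  have e1 := descent_sub_descent v w
  have e2 := descent_sub_descent v.pred w
  have e3 := v.height_pred
  have h := iterate_pred_descent v w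
  have h' := iterate_pred_descent v.pred w
  rw [← Function.iterate_succ_apply] at h'
  have l1 := descent_le h'
  rcases hd : descent v w with _ | a
  · rw [hd, Function.iterate_zero_apply] at h
    have : pred^[0] v.pred = pred^[descent w v + 1] w := by
      rw [Function.iterate_succ_apply', ← h, Function.iterate_zero_apply]
    have l2 := descent_le this
    omega
  · rw [hd, Function.iterate_succ_apply] at h
    have l2 := descent_le h
    omega

lemma descent_of_pred_eq {v u : TreeVertex q} (h : v.pred = u) (w : TreeVertex q) :
    (descent v w = descent u w + 1 ∧ descent w u = descent w v) ∨
      (descent v w = 0 ∧ descent u w = 0 ∧ descent w u = descent w v + 1) :=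
  h ▸ descent_pred v w

lemma descent_iterate_pred (n : ℕ) (v : TreeVertex q) :
    descent (pred^[n] v) v = 0 ∧ descent v (pred^[n] v) = n := by
  have h := descent_le (a := 0) (b := n) (show pred^[0] (pred^[n] v) = pred^[n] v from rfl)
  have e := descent_sub_descent (pred^[n] v) v
  rw [height_iterate_pred] at e
  omega

lemma exists_pred_eq_ne_succOne [hq : Fact (2 ≤ q)] (v : TreeVertex q) :
    ∃ u : TreeVertex q, u.pred = v ∧ u ≠ v.succOne := by
  -- On the descending ray below $o$, the successor labelled $0$ is the previous ray vertex;
  -- elsewhere it is encoded by appending $0$.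
  by_cases hv : 0 < v.down ∧ v.up = []
  · refine ⟨⟨v.down - 1, [], by simp⟩, ?_, fun h => ?_⟩
    · ext1
      · simp only [pred, if_true]; omega
      · simp [pred, hv.2]
    · simpa [succOne] using congrArg up h
  · have h0 : 0 < q := by have := hq.out; omega
    refine ⟨⟨v.down, v.up ++ [⟨0, h0⟩], fun h a ha => ?_⟩, ?_, fun h => ?_⟩
    · rcases hu : v.up with _ | ⟨b, l⟩
      · exact absurd ⟨h, hu⟩ hv
      · exact v.noBacktrack h a (by simpa [hu] using ha)
    · simp [pred]
    · simpa [succOne] using congrArg up h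

/-- Of two successors of `v`, at least one leads away from `w`. -/
lemma descent_eq_succ_of_ne {v s t : TreeVertex q} (hs : s.pred = v) (ht : t.pred = v)
    (hst : s ≠ t) (w : TreeVertex q) :
    (descent s w = descent v w + 1 ∧ descent w s = descent w v) ∨
      (descent t w = descent v w + 1 ∧ descent w t = descent w v) := by
  rcases descent_of_pred_eq hs w with h | h
  · exact Or.inl ⟨h.1, h.2.symm⟩
  rcases descent_of_pred_eq ht w with h' | h'
  · exact Or.inr ⟨h'.1, h'.2.symm⟩
  refine absurd ?_ hst
  have e1 := iterate_pred_descent s w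
  have e2 := iterate_pred_descent t w
  have : descent w s = descent w t := by omega
  rw [h.1, this] at e1
  rw [h'.1] at e2
  exact e1.trans e2.symm

lemma exists_pred_eq_descent_succ [Fact (2 ≤ q)] (v w : TreeVertex q) :
    ∃ u : TreeVertex q, u.pred = v ∧ descent u w = descent v w + 1 ∧
      descent w u = descent w v := by
  obtain ⟨u, hu, hne⟩ := v.exists_pred_eq_ne_succOne
  rcases descent_eq_succ_of_ne hu v.pred_succOne hne w with h | h
  · exact ⟨u, hu, h⟩
  · exact ⟨_, v.pred_succOne, h⟩

lemma exists_pred_eq_of_descent_eq_zero {v w : TreeVertex q} (h : descent v w = 0)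
    (h' : 0 < descent w v) :
    ∃ u : TreeVertex q, u.pred = v ∧ descent u w = 0 ∧ descent w v = descent w u + 1 := by
  have e := iterate_pred_descent v w
  obtain ⟨n, hn⟩ : ∃ n, descent w v = n + 1 := ⟨descent w v - 1, by omega⟩
  rw [h, hn, Function.iterate_succ_apply'] at e
  obtain ⟨h1, h2⟩ := descent_iterate_pred n w
  exact ⟨pred^[n] w, e.symm, h1, by omega⟩

lemma descent_base (v : TreeVertex q) :
    descent v (base q) = v.up.length ∧ descent (base q) v = v.down := by
  have h : pred^[v.up.length] v = pred^[v.down] (base q) := by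
    rw [iterate_pred_length, iterate_pred_base]
  have l := descent_le h
  have e := descent_sub_descent v (base q)
  have e' := sub_eq_of_iterate_pred_eq h
  suffices ¬ descent v (base q) < v.up.length by omega
  intro hlt
  have key : ∀ n (u : TreeVertex q), n < u.up.length → (pred^[n] u).up ≠ [] := by
    intro n
    induction n with
    | zero => intro u hu hn; simp [show u.up = [] from hn] at hu
    | succ n ih =>
      intro u hu
      have hne : u.up ≠ [] := by rintro h; simp [h] at hu
      rw [Function.iterate_succ_apply]
      refine ih _ ?_
      simp only [pred, hne, if_false, List.length_dropLast]
      omega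
  refine key _ v hlt ?_
  rw [iterate_pred_descent, iterate_pred_base]

/-- If the geodesic from `o` to `w` descends further than the one from `o` to `v`, then the
geodesic from `v` to `w` passes through the greatest common ancestor of `o` and `w`. -/
lemma descent_of_lt {o v w : TreeVertex q} (h : descent o v < descent o w) :
    descent v w + descent o v = descent v o + descent o w ∧
      descent w v = descent w o := by
  have e1 := descent_sub_descent v w
  have e2 := descent_sub_descent v o
  have e3 := descent_sub_descent w o
  suffices descent v w + descent o v = descent v o + descent o w by omega
  have h1 := iterate_pred_descent v o
  have h2 := iterate_pred_descent o w
  have h3 := iterate_pred_descent v w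
  obtain ⟨n, hn⟩ := Nat.exists_eq_add_of_lt h
  have up : pred^[n + 1 + descent v o] v = pred^[descent w o] w := by
    rw [← h2, Function.iterate_add_apply, h1, ← Function.iterate_add_apply]
    congr 2
    omega
  have l1 := descent_le up
  by_contra hne
  have hle : descent v w ≤ n + descent v o := by omega
  obtain ⟨c, hc⟩ := Nat.exists_eq_add_of_le hle
  -- If $v$ and $w$ met earlier, an ancestor of $o$ one edge above $o\curlywedge w$ would already be
  -- an ancestor of $w$.
  have lo : pred^[n + descent o v] o = pred^[c + descent w v] w := by
    rw [Function.iterate_add_apply, ← h1, ← Function.iterate_add_apply, hc, add_comm,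
      Function.iterate_add_apply, h3, ← Function.iterate_add_apply]
  have := descent_le lo
  omega

end TreeVertex

/-! ### The distance formula -/

namespace DL

open TreeVertex

variable {q : ℕ}

/-- There is a path of length `N` from `v` to `w` which passes the greatest common ancestors of the
coordinates in some order `i, j, k`; here `m i` and `l i` are the numbers of edges from
`v i` and `w i` down to their common ancestor. -/
def PathBound (m l : Fin 3 → ℕ) (N : ℕ) : Prop :=
  ∃ i j k : Fin 3, i ≠ j ∧ j ≠ k ∧ i ≠ k ∧ m i + l k + (m i + m j + m k) ≤ N ∧
    m i + l k + (m j + l j) ≤ N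

lemma pathBound_iff (m l : Fin 3 → ℕ) (N : ℕ) : PathBound m l N ↔
    (m 0 + l 2 + (m 0 + m 1 + m 2) ≤ N ∧ m 0 + l 2 + (m 1 + l 1) ≤ N) ∨
    (m 0 + l 1 + (m 0 + m 1 + m 2) ≤ N ∧ m 0 + l 1 + (m 2 + l 2) ≤ N) ∨
    (m 1 + l 2 + (m 0 + m 1 + m 2) ≤ N ∧ m 1 + l 2 + (m 0 + l 0) ≤ N) ∨
    (m 1 + l 0 + (m 0 + m 1 + m 2) ≤ N ∧ m 1 + l 0 + (m 2 + l 2) ≤ N) ∨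
    (m 2 + l 1 + (m 0 + m 1 + m 2) ≤ N ∧ m 2 + l 1 + (m 0 + l 0) ≤ N) ∨
    (m 2 + l 0 + (m 0 + m 1 + m 2) ≤ N ∧ m 2 + l 0 + (m 1 + l 1) ≤ N) := by
  constructor
  · rintro ⟨i, j, k, hij, hjk, hik, h⟩
    fin_cases i <;> fin_cases j <;> fin_cases k <;> simp at hij hjk hik <;> simp at h <;> omega
  · rintro (h | h | h | h | h | h)
    · exact ⟨0, 1, 2, by decide, by decide, by decide, by omega⟩
    · exact ⟨0, 2, 1, by decide, by decide, by decide, by omega⟩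
    · exact ⟨1, 0, 2, by decide, by decide, by decide, by omega⟩
    · exact ⟨1, 2, 0, by decide, by decide, by decide, by omega⟩
    · exact ⟨2, 0, 1, by decide, by decide, by decide, by omega⟩
    · exact ⟨2, 1, 0, by decide, by decide, by decide, by omega⟩

lemma eq_or_eq_or_eq_of_ne {i j k : Fin 3} (hij : i ≠ j) (hjk : j ≠ k) (hik : i ≠ k)
    (r : Fin 3) : r = i ∨ r = j ∨ r = k := by
  omega

lemma sum_eq_of_ne {i j k : Fin 3} (hij : i ≠ j) (hjk : j ≠ k) (hik : i ≠ k) (f : Fin 3 → ℤ) :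
    ∑ r, f r = f i + f j + f k := by
  rw [Fin.sum_univ_three]
  fin_cases i <;> fin_cases j <;> fin_cases k <;> simp at hij hjk hik <;> simp <;> ring

/-- The numbers of edges from the coordinates of `v` down to the common ancestors with those
of `w`. -/
noncomputable def descents (v w : DL 3 q) (i : Fin 3) : ℕ := descent (v.coord i) (w.coord i)

lemma descents_sum {i j k : Fin 3} (hij : i ≠ j) (hjk : j ≠ k) (hik : i ≠ k) (v w : DL 3 q) :
    descents v w i + descents v w j + descents v w k =
      descents w v i + descents w v j + descents w v k := by
  have hv := v.sum_height
  have hw := w.sum_height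
  rw [sum_eq_of_ne hij hjk hik] at hv hw
  have e := fun r => descent_sub_descent (v.coord r) (w.coord r)
  have e1 := e i
  have e2 := e j
  have e3 := e k
  simp only [descents]
  omega

/-- This is the lower bound on distances: one edge changes the bound by at most one. The order that
works for the neighbour may have to be replaced by another one, so all six are refuted together. -/
lemma PathBound.of_step {m l m' l' : Fin 3 → ℕ} {a b c : Fin 3} {N : ℕ} (hab : a ≠ b)
    (hbc : b ≠ c) (hac : a ≠ c) (hs : m a + m b + m c = l a + l b + l c)
    (ha : (m a = m' a + 1 ∧ l' a = l a) ∨ (m a = 0 ∧ m' a = 0 ∧ l' a = l a + 1))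
    (hb : (m' b = m b + 1 ∧ l b = l' b) ∨ (m' b = 0 ∧ m b = 0 ∧ l b = l' b + 1))
    (hc : m' c = m c ∧ l' c = l c) (h : PathBound m' l' N) : PathBound m l (N + 1) := by
  by_contra hcon
  have key : ∀ i j k : Fin 3, i ≠ j → j ≠ k → i ≠ k →
      ¬ (m i + l k + (m i + m j + m k) ≤ N + 1 ∧ m i + l k + (m j + l j) ≤ N + 1) :=
    fun i j k h1 h2 h3 h4 => hcon ⟨i, j, k, h1, h2, h3, h4⟩
  have k1 := key a b c hab hbc hac
  have k2 := key a c b hac hbc.symm hab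
  have k3 := key b a c hab.symm hac hbc
  have k4 := key b c a hbc hac.symm hab.symm
  have k5 := key c a b hac.symm hab hbc.symm
  have k6 := key c b a hbc.symm hab.symm hac.symm
  clear key hcon
  obtain ⟨i, j, k, hij, hjk, hik, h⟩ := h
  obtain ⟨hc1, hc2⟩ := hc
  rcases eq_or_eq_or_eq_of_ne hab hbc hac i with rfl | rfl | rfl <;>
  rcases eq_or_eq_or_eq_of_ne hab hbc hac j with rfl | rfl | rfl <;>
  first
  | exact absurd rfl hij
  | (rcases eq_or_eq_or_eq_of_ne hab hbc hac k with rfl | rfl | rfl <;>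
    first
    | exact absurd rfl hik
    | exact absurd rfl hjk
    | (rcases ha with ha | ha <;> rcases hb with hb | hb <;> omega))

/-- Two adjacent vertices differ by a downward edge in one coordinate and an upward edge in
another. -/
lemma exists_pred_eq_of_adj {v w : DL 3 q} (h : (graph 3 q).Adj v w) :
    ∃ i j k : Fin 3, i ≠ j ∧ j ≠ k ∧ i ≠ k ∧ (v.coord i).pred = w.coord i ∧
      (w.coord j).pred = v.coord j ∧ w.coord k = v.coord k := by
  obtain ⟨i, j, hij, hi, hj, h⟩ := h
  obtain ⟨k, hik, hjk⟩ := (show ∀ i j : Fin 3, ∃ k, i ≠ k ∧ j ≠ k by decide) i j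
  have hk := h k hik.symm hjk.symm
  have hv := v.sum_height
  have hw := w.sum_height
  rw [sum_eq_of_ne hij hjk hik] at hv hw
  rw [hk] at hv
  have p := fun r => (v.coord r).height_pred
  have p' := fun r => (w.coord r).height_pred
  have e1 := p i
  have e2 := p j
  have e3 := p' i
  have e4 := p' j
  rcases hi with hi | hi <;> rcases hj with hj | hj
  · rw [hi] at e1; rw [hj] at e2; omega
  · exact ⟨i, j, k, hij, hjk, hik, hi, hj, hk.symm⟩
  · exact ⟨j, i, k, hij.symm, hik, hjk, hj, hi, hk.symm⟩
  · rw [hi] at e3; rw [hj] at e4; omega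

lemma pathBound_of_walk {v w : DL 3 q} (p : (graph 3 q).Walk v w) :
    PathBound (descents v w) (descents w v) p.length := by
  induction p with
  | nil => exact ⟨0, 1, 2, by decide, by decide, by decide, by simp [descents]⟩
  | @cons u v w huv p ih =>
    obtain ⟨i, j, k, hij, hjk, hik, hi, hj, hk⟩ := exists_pred_eq_of_adj huv
    exact PathBound.of_step (m' := descents v w) (l' := descents w v) hij hjk hik
      (descents_sum hij hjk hik u w)
      (descent_of_pred_eq hi _) (descent_of_pred_eq hj _)
      ⟨by simp [descents, hk], by simp [descents, hk]⟩ ih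

lemma exists_adj_of_pred {v : DL 3 q} {i j k : Fin 3} (hij : i ≠ j) (hjk : j ≠ k) (hik : i ≠ k)
    {b : TreeVertex q} (hb : b.pred = v.coord j) (w : DL 3 q) :
    ∃ u : DL 3 q, (graph 3 q).Adj v u ∧
      ((descents v w i = descents u w i + 1 ∧ descents w u i = descents w v i) ∨
        (descents v w i = 0 ∧ descents u w i = 0 ∧ descents w u i = descents w v i + 1)) ∧
      (descents u w j = descent b (w.coord j) ∧ descents w u j = descent (w.coord j) b) ∧
      (descents u w k = descents v w k ∧ descents w u k = descents w v k) := by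
  have h1 := (v.coord i).height_pred
  have h2 := b.height_pred
  rw [hb] at h2
  obtain ⟨u, hvu, hi, hj, hk⟩ := v.exists_adj hij (a := (v.coord i).pred) (b := b) (Or.inl rfl)
    (Or.inr hb) (by linarith)
  refine ⟨u, hvu, descent_of_pred_eq hi.symm _, ?_, ?_⟩
  · simp [descents, hj]
  · simp [descents, hk k hik.symm hjk.symm]

/-- One step towards `w`: down in coordinate `i` and up in coordinate `j`, away from `w`. -/
lemma exists_adj_away [Fact (2 ≤ q)] {i j k : Fin 3} (hij : i ≠ j) (hjk : j ≠ k) (hik : i ≠ k)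
    {v w : DL 3 q} (hi : 0 < descents v w i) :
    ∃ u : DL 3 q, (graph 3 q).Adj v u ∧
      (descents v w i = descents u w i + 1 ∧ descents w u i = descents w v i) ∧
      (descents u w j = descents v w j + 1 ∧ descents w u j = descents w v j) ∧
      (descents u w k = descents v w k ∧ descents w u k = descents w v k) := by
  obtain ⟨b, hb, hb'⟩ := exists_pred_eq_descent_succ (v.coord j) (w.coord j)
  obtain ⟨u, hu, h1, h2, h3⟩ := exists_adj_of_pred hij hjk hik hb w
  refine ⟨u, hu, ?_, ?_, h3⟩
  · omega
  · exact ⟨h2.1.trans hb'.1, h2.2.trans hb'.2⟩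

/-- One step towards `w`: down in coordinate `i` and up in coordinate `j`, towards `w`. -/
lemma exists_adj_towards {i j k : Fin 3} (hij : i ≠ j) (hjk : j ≠ k) (hik : i ≠ k)
    {v w : DL 3 q} (hi : 0 < descents v w i) (hj : descents v w j = 0)
    (hj' : 0 < descents w v j) :
    ∃ u : DL 3 q, (graph 3 q).Adj v u ∧
      (descents v w i = descents u w i + 1 ∧ descents w u i = descents w v i) ∧
      (descents u w j = 0 ∧ descents w v j = descents w u j + 1) ∧
      (descents u w k = descents v w k ∧ descents w u k = descents w v k) := by
  obtain ⟨b, hb, hb'⟩ := exists_pred_eq_of_descent_eq_zero hj hj'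
  obtain ⟨u, hu, h1, h2, h3⟩ := exists_adj_of_pred hij hjk hik hb w
  refine ⟨u, hu, ?_, ?_, h3⟩
  · omega
  · exact ⟨h2.1.trans hb'.1, hb'.2.trans (by rw [h2.2])⟩

lemma eq_of_descents_eq_zero {i j k : Fin 3} (hij : i ≠ j) (hjk : j ≠ k) (hik : i ≠ k)
    {v w : DL 3 q} (h : descents v w i + descents v w j + descents v w k = 0) : v = w := by
  have e := descents_sum hij hjk hik v w
  ext1
  funext r
  apply eq_of_descent_eq_zero <;> change descents _ _ r = 0 <;>
  rcases eq_or_eq_or_eq_of_ne hij hjk hik r with rfl | rfl | rfl <;> omega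

/-- Each case takes one edge that lowers the bound for the same order $(i,j,k)$: exhaust $m_i$ by
descending in $i$ while climbing away in $k$, do the same backwards from $w$ to exhaust $l_k$, and
then finish with steps towards $w$ wherever possible. -/
lemma dist_le_of_pathBound [Fact (2 ≤ q)] {N : ℕ} {v w : DL 3 q}
    (h : PathBound (descents v w) (descents w v) N) : (graph 3 q).dist v w ≤ N := by
  have hstep : ∀ {v u w : DL 3 q} {N : ℕ}, (graph 3 q).Adj v u → (graph 3 q).dist u w ≤ N →
      (graph 3 q).dist v w ≤ N + 1 := fun {v u w N} hvu h => by
    have h1 := (connected q).dist_triangle (u := v) (v := u) (w := w)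
    have h2 := SimpleGraph.dist_eq_one_iff_adj.2 hvu
    omega
  induction N generalizing v w with
  | zero =>
    obtain ⟨i, j, k, hij, hjk, hik, h, -⟩ := h
    rw [eq_of_descents_eq_zero hij hjk hik (v := v) (w := w) (by omega)]
    simp
  | succ N ih =>
    obtain ⟨i, j, k, hij, hjk, hik, h1, h2⟩ := h
    have hs := descents_sum hij hjk hik v w
    rcases Nat.eq_zero_or_pos (descents v w i + descents v w j + descents v w k) with h0 | hpos
    · rw [eq_of_descents_eq_zero hij hjk hik h0]
      simp
    rcases Nat.eq_zero_or_pos (descents v w i) with hi | hi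
    swap
    · obtain ⟨u, hu, hui, huk, huj⟩ := exists_adj_away hik hjk.symm hij hi
      exact hstep hu (ih ⟨i, j, k, hij, hjk, hik, by omega, by omega⟩)
    rcases Nat.eq_zero_or_pos (descents w v k) with hk | hk
    swap
    · obtain ⟨u, hu, huk, hui, huj⟩ := exists_adj_away hik.symm hij hjk.symm hk
      -- The edge is taken at the end $w$: the last part of the path climbs in $k$.
      rw [SimpleGraph.dist_comm]
      have hs' := descents_sum hij hjk hik v u
      refine hstep hu ?_
      rw [SimpleGraph.dist_comm]
      exact ih ⟨i, j, k, hij, hjk, hik, by omega, by omega⟩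
    -- Now $m_i=l_k=0$, so $m_j+m_k=l_i+l_j$ and the bound is $\max(m_j+m_k,\,m_j+l_j)$. A step away
    -- is needed only if $m_j>0$ and $l_i=0$; then $m_j+l_j$ is the larger term and it still drops.
    rcases Nat.eq_zero_or_pos (descents v w j) with hj | hj
    · rcases Nat.eq_zero_or_pos (descents w v j) with hj' | hj'
      · obtain ⟨u, hu, huk, hui, huj⟩ := exists_adj_towards hik.symm hij hjk.symm
          (v := v) (w := w) (by omega) hi (by omega)
        exact hstep hu (ih ⟨i, j, k, hij, hjk, hik, by omega, by omega⟩)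
      · obtain ⟨u, hu, huk, huj, hui⟩ := exists_adj_towards hjk.symm hij.symm hik.symm
          (v := v) (w := w) (by omega) hj hj'
        exact hstep hu (ih ⟨i, j, k, hij, hjk, hik, by omega, by omega⟩)
    · rcases Nat.eq_zero_or_pos (descents w v i) with hi' | hi'
      · obtain ⟨u, hu, huj, huk, hui⟩ := exists_adj_away hjk hik.symm hij.symm hj
        exact hstep hu (ih ⟨i, j, k, hij, hjk, hik, by omega, by omega⟩)
      · obtain ⟨u, hu, huj, hui, huk⟩ := exists_adj_towards hij.symm hik hjk hj hi hi'
        exact hstep hu (ih ⟨i, j, k, hij, hjk, hik, by omega, by omega⟩)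

/-- The distance formula in `DL_3(q)`. -/
theorem dist_le_iff [Fact (2 ≤ q)] {N : ℕ} {v w : DL 3 q} :
    (graph 3 q).dist v w ≤ N ↔ PathBound (descents v w) (descents w v) N := by
  refine ⟨fun h => ?_, dist_le_of_pathBound⟩
  obtain ⟨p, hp⟩ := (connected q).exists_walk_length_eq_dist v w
  obtain ⟨i, j, k, hij, hjk, hik, h1, h2⟩ := pathBound_of_walk p
  exact ⟨i, j, k, hij, hjk, hik, by omega, by omega⟩

end DL

/-! ### Iterated successors and the sibling of the base vertex -/

namespace TreeVertex

variable {q : ℕ}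

lemma iterate_pred_succOne [Fact (2 ≤ q)] (n : ℕ) (v : TreeVertex q) :
    pred^[n] (succOne^[n] v) = v :=
  Function.LeftInverse.iterate (fun u => u.pred_succOne) n v

lemma height_iterate_succOne [Fact (2 ≤ q)] (n : ℕ) (v : TreeVertex q) :
    (succOne^[n] v).height = v.height + n := by
  have h := height_iterate_pred n (succOne^[n] v)
  rw [iterate_pred_succOne] at h
  linarith

lemma height_base : (base q).height = 0 := by simp [height, base]

lemma descent_iterate_succOne [Fact (2 ≤ q)] (n : ℕ) (v : TreeVertex q) :
    descent v (succOne^[n] v) = 0 ∧ descent (succOne^[n] v) v = n := by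
  have h := descent_iterate_pred n (succOne^[n] v)
  rwa [iterate_pred_succOne] at h

/-- The geodesic from `v` to `w` starts with the edge to `v.pred`, which is equally available from
`s`. -/
lemma descent_le_of_pred_eq_pred {s v w : TreeVertex q} (h : s.pred = v.pred)
    (hv : 0 < descent v w) : descent s w ≤ descent v w ∧ descent w s ≤ descent w v := by
  have h1 := descent_of_pred_eq h w
  have h2 := descent_pred v w
  omega

/-- The vertex next to `o`, reached by going down one edge and up the edge labelled `1`. -/
def sibling (q : ℕ) [Fact (2 ≤ q)] : TreeVertex q := (base q).pred.succOne

lemma pred_sibling [Fact (2 ≤ q)] : (sibling q).pred = (base q).pred := pred_succOne _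

lemma height_sibling [Fact (2 ≤ q)] : (sibling q).height = 0 := by
  simp [height, sibling, succOne, pred, base]

lemma descent_sibling [Fact (2 ≤ q)] :
    descent (sibling q) (base q) = 1 ∧ descent (base q) (sibling q) = 1 := by
  rw [(descent_base _).1, (descent_base _).2]
  simp [sibling, succOne, pred, base]

end TreeVertex

/-! ### Hanging vertices and the horofunction they define -/

namespace DL

open TreeVertex

variable {q : ℕ}

lemma PathBound.mono {m l m' l' : Fin 3 → ℕ} {N : ℕ} (h : PathBound m l N)
    (hm : ∀ i, m' i ≤ m i) (hl : ∀ i, l' i ≤ l i) : PathBound m' l' N := by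
  obtain ⟨i, j, k, hij, hjk, hik, h1, h2⟩ := h
  refine ⟨i, j, k, hij, hjk, hik, ?_, ?_⟩ <;>
    linarith [hm i, hm j, hm k, hl k, hl j]

lemma dist_def [Fact (2 ≤ q)] (v w : DL 3 q) : dist v w = ((graph 3 q).dist v w : ℝ) := rfl

lemma pathBound_dist [Fact (2 ≤ q)] (v w : DL 3 q) :
    PathBound (descents v w) (descents w v) ((graph 3 q).dist v w) := dist_le_iff.1 le_rfl

instance instDiscreteTopology [Fact (2 ≤ q)] : DiscreteTopology (DL 3 q) := by
  refine DiscreteTopology.of_forall_le_dist (r := 1) one_pos fun v w h => ?_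
  change 1 ≤ ((graph 3 q).dist v w : ℝ)
  exact_mod_cast (connected q).pos_dist_of_ne h

/-- The vertex with first coordinates `s` and `t`, the third being an ancestor of `o`. -/
def ofPair (s t : TreeVertex q) (n : ℕ) (h : s.height + t.height = n) : DL 3 q where
  coord := ![s, t, pred^[n] (TreeVertex.base q)]
  sum_height := by
    simp [Fin.sum_univ_three, height_iterate_pred, height_base, h]

lemma descents_ofPair (s t : TreeVertex q) (n : ℕ) (h : s.height + t.height = n) (w : DL 3 q) :
    (descents (ofPair s t n h) w 0 = descent s (w.coord 0) ∧
      descents w (ofPair s t n h) 0 = descent (w.coord 0) s) ∧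
    (descents (ofPair s t n h) w 1 = descent t (w.coord 1) ∧
      descents w (ofPair s t n h) 1 = descent (w.coord 1) t) ∧
    (descents (ofPair s t n h) w 2 = descent (pred^[n] (TreeVertex.base q)) (w.coord 2) ∧
      descents w (ofPair s t n h) 2 = descent (w.coord 2) (pred^[n] (TreeVertex.base q))) :=
  ⟨⟨rfl, rfl⟩, ⟨rfl, rfl⟩, ⟨rfl, rfl⟩⟩

/-- The vertices which, like `β_n`, are trivial in the first two trees and go down `n` edges, then
up `n` edges in the third one. -/
def hanging (q n : ℕ) : Set (DL 3 q) :=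
  {x | x.coord 0 = TreeVertex.base q ∧ x.coord 1 = TreeVertex.base q ∧ (x.coord 2).down = n}

lemma betaSeq_mem_hanging [Fact (2 ≤ q)] (n : ℕ) : betaSeq q n ∈ hanging q n :=
  ⟨rfl, rfl, rfl⟩

lemma length_up_of_mem_hanging {n : ℕ} {x : DL 3 q} (hx : x ∈ hanging q n) :
    (x.coord 2).up.length = n := by
  obtain ⟨h0, h1, h2⟩ := hx
  have h := x.sum_height
  rw [Fin.sum_univ_three, h0, h1, height_base, height, h2] at h
  omega

lemma mem_hanging_down {x : DL 3 q} (h0 : x.coord 0 = TreeVertex.base q)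
    (h1 : x.coord 1 = TreeVertex.base q) : x ∈ hanging q (x.coord 2).down :=
  ⟨h0, h1, rfl⟩

lemma finite_hanging (N : ℕ) : {x : DL 3 q | ∃ n < N, x ∈ hanging q n}.Finite := by
  refine Set.Finite.of_finite_image (f := fun x : DL 3 q => (x.coord 2).up)
    ((List.finite_length_lt (Fin q) N).subset ?_) ?_
  · rintro _ ⟨x, ⟨n, hn, hx⟩, rfl⟩
    exact (length_up_of_mem_hanging hx).trans_lt hn
  · rintro x ⟨n, -, hx⟩ y ⟨n', -, hy⟩ (hxy : (x.coord 2).up = (y.coord 2).up)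
    have hx' := length_up_of_mem_hanging hx
    have hy' := length_up_of_mem_hanging hy
    ext1
    funext i
    fin_cases i
    · exact hx.1.trans hy.1.symm
    · exact hx.2.1.trans hy.2.1.symm
    · refine TreeVertex.ext ?_ hxy
      change (x.coord 2).down = (y.coord 2).down
      rw [hx.2.2, hy.2.2, ← hx', ← hy', hxy]

lemma descents_base_hanging {n : ℕ} {x : DL 3 q} (hx : x ∈ hanging q n) :
    (descents (base 3 q) x 0 = 0 ∧ descents x (base 3 q) 0 = 0) ∧
    (descents (base 3 q) x 1 = 0 ∧ descents x (base 3 q) 1 = 0) ∧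
    (descents (base 3 q) x 2 = n ∧ descents x (base 3 q) 2 = n) := by
  have hl := length_up_of_mem_hanging hx
  obtain ⟨h0, h1, h2⟩ := hx
  have e := descent_base (x.coord 2)
  simp only [descents, h0, h1]
  exact ⟨⟨descent_self _, descent_self _⟩, ⟨descent_self _, descent_self _⟩,
    e.2.trans h2, e.1.trans hl⟩

/-- When $x$ hangs deep enough, the path from $z_3$ to $x_3$ passes through $o\curlywedge x_3$, so
$x$ enters the descents only through $n$. -/
lemma descents_hanging {n : ℕ} {x z : DL 3 q} (hx : x ∈ hanging q n)
    (hn : descents (base 3 q) z 2 < n) :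
    (descents z x 0 = descents z (base 3 q) 0 ∧ descents x z 0 = descents (base 3 q) z 0) ∧
    (descents z x 1 = descents z (base 3 q) 1 ∧ descents x z 1 = descents (base 3 q) z 1) ∧
    (descents z x 2 + descents (base 3 q) z 2 = descents z (base 3 q) 2 + n ∧
      descents x z 2 = n) := by
  have e := (descents_base_hanging hx).2.2
  obtain ⟨h0, h1, h2⟩ := hx
  have key := descent_of_lt (o := (base 3 q).coord 2) (v := z.coord 2) (w := x.coord 2)
    (by change descents (base 3 q) z 2 < descents (base 3 q) x 2; omega)
  change descents z x 2 + descents (base 3 q) z 2 = descents z (base 3 q) 2 +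
    descents (base 3 q) x 2 ∧ descents x z 2 = descents x (base 3 q) 2 at key
  refine ⟨?_, ?_, by omega⟩
  · simp [descents, h0, base]
  · simp [descents, h1, base]

/-- From here on the vertices hanging below `o` are far away as seen from `z`. -/
noncomputable def threshold (z : DL 3 q) : ℕ :=
  descents z (base 3 q) 0 + descents z (base 3 q) 1 + descents z (base 3 q) 2 +
    descents (base 3 q) z 0 + descents (base 3 q) z 1 + descents (base 3 q) z 2 + 1

/-- Increasing $n$ by one adds one to both $m$ and $l$ in the third tree. Beyond the threshold the
maximum is $m_i+m_j+m_k$ if the third tree comes first or last in the order, and $m_j+l_j$ if it is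
in the middle; either way the length grows by exactly $2$. -/
lemma pathBound_hanging {n n' N N' : ℕ} {x x' z : DL 3 q} (hx : x ∈ hanging q n)
    (hx' : x' ∈ hanging q n') (hn : threshold z ≤ n) (hn' : threshold z ≤ n')
    (hN : N + 2 * n' = N' + 2 * n) (h : PathBound (descents z x) (descents x z) N) :
    PathBound (descents z x') (descents x' z) N' := by
  unfold threshold at hn hn'
  obtain ⟨⟨a1, a2⟩, ⟨a3, a4⟩, a5, a6⟩ := descents_hanging (z := z) hx (by omega)
  obtain ⟨⟨b1, b2⟩, ⟨b3, b4⟩, b5, b6⟩ := descents_hanging (z := z) hx' (by omega)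
  rw [pathBound_iff] at h ⊢
  rcases h with h | h | h | h | h | h
  · exact Or.inl (by omega)
  · exact Or.inr (Or.inl (by omega))
  · exact Or.inr (Or.inr (Or.inl (by omega)))
  · exact Or.inr (Or.inr (Or.inr (Or.inl (by omega))))
  · exact Or.inr (Or.inr (Or.inr (Or.inr (Or.inl (by omega)))))
  · exact Or.inr (Or.inr (Or.inr (Or.inr (Or.inr (by omega)))))

variable [Fact (2 ≤ q)]

lemma dist_base_hanging {n : ℕ} {x : DL 3 q} (hx : x ∈ hanging q n) :
    (graph 3 q).dist (base 3 q) x = 2 * n := by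
  have e := descents_base_hanging hx
  apply le_antisymm
  · rw [dist_le_iff, pathBound_iff]
    omega
  · have h := pathBound_dist (base 3 q) x
    rw [pathBound_iff] at h
    omega

lemma dist_hanging {n n' : ℕ} {x x' z : DL 3 q} (hx : x ∈ hanging q n)
    (hx' : x' ∈ hanging q n') (hn : threshold z ≤ n) (hn' : threshold z ≤ n') :
    (graph 3 q).dist z x + 2 * n' = (graph 3 q).dist z x' + 2 * n := by
  have key : ∀ {n n' : ℕ} {x x' : DL 3 q}, x ∈ hanging q n → x' ∈ hanging q n' →
      threshold z ≤ n → threshold z ≤ n' →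
      (graph 3 q).dist z x + 2 * n' ≤ (graph 3 q).dist z x' + 2 * n := by
    intro n n' x x' hx hx' hn hn'
    by_contra! hlt
    have h1 := pathBound_dist z x'
    have htri := (connected q).dist_triangle (u := base 3 q) (v := z) (w := x')
    -- With the triangle inequality this gives $2n'\le d(z,x')+2n$, so the natural subtraction below
    -- is not truncated.
    have hle : (graph 3 q).dist (base 3 q) z ≤ 2 * n := by
      rw [dist_le_iff, pathBound_iff]
      unfold threshold at hn
      omega
    rw [dist_base_hanging hx'] at htri
    have h2 : PathBound (descents z x) (descents x z)
        ((graph 3 q).dist z x' + 2 * n - 2 * n') :=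
      pathBound_hanging hx' hx hn' hn (by omega) h1
    have h3 := dist_le_iff.2 h2
    omega
  exact le_antisymm (key hx hx' hn hn') (key hx' hx hn' hn)

/-- The horofunction defined by the sequence `β_n`. -/
noncomputable def beta (q : ℕ) [Fact (2 ≤ q)] : C(DL 3 q, ℝ) where
  toFun z := (graph 3 q).dist z (betaSeq q (threshold z)) - 2 * (threshold z : ℝ)
  continuous_toFun := continuous_of_discreteTopology

lemma horoMap_hanging_apply {n : ℕ} {x : DL 3 q} (hx : x ∈ hanging q n) (z : DL 3 q) :
    horoMap (base 3 q) x z = (graph 3 q).dist z x - 2 * (n : ℝ) := by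
  change dist x z - dist x (base 3 q) = _
  rw [dist_comm x z, dist_comm x, dist_def, dist_def, dist_base_hanging hx]
  push_cast
  ring

/-- This holds for every hanging vertex and not just for $\beta_n$, which is what isolation needs.
-/
lemma horoMap_hanging {n : ℕ} {x z : DL 3 q} (hx : x ∈ hanging q n) (hn : threshold z ≤ n) :
    horoMap (base 3 q) x z = beta q z := by
  rw [horoMap_hanging_apply hx]
  have h := dist_hanging hx (betaSeq_mem_hanging (threshold z)) hn le_rfl
  have h' : ((graph 3 q).dist z x : ℝ) + 2 * (threshold z : ℝ) =
    (graph 3 q).dist z (betaSeq q (threshold z)) + 2 * (n : ℝ) := by exact_mod_cast h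
  change _ = ((graph 3 q).dist z (betaSeq q (threshold z)) : ℝ) - 2 * (threshold z : ℝ)
  linarith

lemma isHorofunctionOf_beta : IsHorofunctionOf (base 3 q) (betaSeq q) (beta q) := fun z =>
  tendsto_const_nhds.congr' (by
    filter_upwards [eventually_ge_atTop (threshold z)] with n hn
    exact (horoMap_hanging (betaSeq_mem_hanging n) hn).symm)

/-- On a discrete space the compact-open topology is that of pointwise convergence. -/
lemma tendsto_of_forall_apply {ι : Type*} {l : Filter ι} {f : ι → C(DL 3 q, ℝ)} {g : C(DL 3 q, ℝ)}
    (h : ∀ z, Tendsto (fun n => f n z) l (𝓝 (g z))) : Tendsto f l (𝓝 g) := by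
  rw [(ContinuousMap.isHomeomorph_coe (X := DL 3 q) (Y := ℝ)).isInducing.tendsto_nhds_iff,
    tendsto_pi_nhds]
  exact h

lemma tendsto_horoMap_betaSeq :
    Tendsto (fun n => horoMap (base 3 q) (betaSeq q n)) atTop (𝓝 (beta q)) :=
  tendsto_of_forall_apply isHorofunctionOf_beta

/-- A bound on `β(z)` obtained from a path from `z` to a far away `β_n`. -/
lemma beta_le {z : DL 3 q} {c : ℤ}
    (h : ∀ n, threshold z ≤ n → ∃ N : ℕ, (N : ℤ) ≤ 2 * n + c ∧
      PathBound (descents z (betaSeq q n)) (descents (betaSeq q n) z) N) : beta q z ≤ c := by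
  obtain ⟨N, hN, hb⟩ := h _ le_rfl
  have h1 : ((graph 3 q).dist z (betaSeq q (threshold z)) : ℤ) ≤ 2 * threshold z + c :=
    le_trans (by exact_mod_cast dist_le_iff.2 hb) hN
  have h2 : ((graph 3 q).dist z (betaSeq q (threshold z)) : ℝ) ≤ 2 * threshold z + c := by
    exact_mod_cast h1
  change ((graph 3 q).dist z (betaSeq q (threshold z)) : ℝ) - 2 * (threshold z : ℝ) ≤ _
  linarith

/-- The vertex reached by going up `a` edges in the first tree, `b` in the second, and down
`a + b` edges in the third one. -/
def upUpDown (q : ℕ) [Fact (2 ≤ q)] (a b : ℕ) : DL 3 q :=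
  ofPair (succOne^[a] (TreeVertex.base q)) (succOne^[b] (TreeVertex.base q)) (a + b)
    (by rw [height_iterate_succOne, height_iterate_succOne, height_base]; push_cast; ring)

/-- Moving upwards in the first two trees and downwards in the third one approaches `β`. -/
lemma beta_ofPair_le {s t : TreeVertex q} {n : ℕ} (h : s.height + t.height = n)
    (hs : descent (TreeVertex.base q) s = 0) (ht : descent (TreeVertex.base q) t = 0) :
    beta q (ofPair s t n h) ≤ -(n : ℝ) := by
  have key : beta q (ofPair s t n h) ≤ ((-(n : ℤ) : ℤ) : ℝ) := by
    refine beta_le fun k hk => ⟨2 * k - n, ?_, ?_⟩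
    all_goals
      have e1 := descents_ofPair s t n h (base 3 q)
      have e2 := descents_sum (i := 0) (j := 1) (k := 2) (by decide) (by decide) (by decide)
        (ofPair s t n h) (base 3 q)
      have e3 := descent_iterate_pred n (TreeVertex.base q)
      have e4 : ∀ i, (base 3 q).coord i = TreeVertex.base q := fun _ => rfl
      simp only [e4] at e1
      unfold threshold at hk
    · omega
    · have e5 := descents_hanging (z := ofPair s t n h) (betaSeq_mem_hanging k) (by omega)
      rw [pathBound_iff]
      -- The order with the third tree first: $m_3=k-n$, $m_1+m_2+m_3=k$ and $l_2=0$, for a total of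
      -- $2k-n$.
      refine Or.inr (Or.inr (Or.inr (Or.inr (Or.inl ?_))))
      omega
  simpa using key

/-- Each $f_x$ is bounded below by $-d(x,id)$, whereas $\beta$ is at most $-n$ at `upUpDown q n 0`.
-/
lemma beta_notMem_range : beta q ∉ range (horoMap (base 3 q)) := by
  rintro ⟨x, hx⟩
  obtain ⟨n, hn⟩ := exists_nat_gt (dist x (base 3 q))
  have h1 : beta q (upUpDown q n 0) ≤ -((n + 0 : ℕ) : ℝ) :=
    beta_ofPair_le _ (descent_iterate_succOne _ _).1 (descent_iterate_succOne _ _).1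
  rw [← hx] at h1
  change dist x _ - dist x (base 3 q) ≤ _ at h1
  have := dist_nonneg (x := x) (y := upUpDown q n 0)
  push_cast at h1
  linarith

lemma beta_mem_horoBoundary : beta q ∈ horoBoundary (base 3 q) :=
  ⟨mem_closure_of_tendsto tendsto_horoMap_betaSeq (Eventually.of_forall fun _ => mem_range_self _),
    beta_notMem_range⟩

end DL

/-! ### Isolation of the horofunction in the boundary -/

namespace DL

open TreeVertex

variable {q : ℕ} [Fact (2 ≤ q)]

lemma exists_beta_eq (z : DL 3 q) : ∃ n : ℕ,
    beta q z = (graph 3 q).dist z (betaSeq q n) - 2 * (n : ℝ) :=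
  ⟨_, rfl⟩

/-- The vertex `(sibling, o, o)`. -/
def siblingFst (q : ℕ) [Fact (2 ≤ q)] : DL 3 q :=
  ofPair (sibling q) (TreeVertex.base q) 0 (by simp [height_sibling, height_base])

/-- The vertex `(o, sibling, o)`. -/
def siblingSnd (q : ℕ) [Fact (2 ≤ q)] : DL 3 q :=
  ofPair (TreeVertex.base q) (sibling q) 0 (by simp [height_sibling, height_base])

/-- Here $m=l=(1,0,n)$, and each of the six orders costs at least $2n+1$. -/
lemma beta_siblingFst_pos : 0 < beta q (siblingFst q) := by
  obtain ⟨n, h⟩ := exists_beta_eq (siblingFst q)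
  rw [h, sub_pos]
  suffices 2 * n < (graph 3 q).dist (siblingFst q) (betaSeq q n) by exact_mod_cast this
  obtain ⟨a0, a1, a2⟩ := descents_ofPair (sibling q) (TreeVertex.base q) 0
    (by simp [height_sibling, height_base]) (betaSeq q n)
  change _ = descent (sibling q) (TreeVertex.base q) ∧
    _ = descent (TreeVertex.base q) (sibling q) at a0
  rw [descent_sibling.1, descent_sibling.2] at a0
  have e := descents_base_hanging (betaSeq_mem_hanging (q := q) n)
  have hb := pathBound_dist (siblingFst q) (betaSeq q n)
  change _ = descents (base 3 q) (betaSeq q n) 2 ∧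
    _ = descents (betaSeq q n) (base 3 q) 2 at a2
  change descents (siblingFst q) (betaSeq q n) 0 = _ ∧
    descents (betaSeq q n) (siblingFst q) 0 = _ at a0
  change descents (siblingFst q) (betaSeq q n) 2 = _ ∧
    descents (betaSeq q n) (siblingFst q) 2 = _ at a2
  rw [pathBound_iff] at hb
  omega

lemma beta_siblingSnd_pos : 0 < beta q (siblingSnd q) := by
  obtain ⟨n, h⟩ := exists_beta_eq (siblingSnd q)
  rw [h, sub_pos]
  suffices 2 * n < (graph 3 q).dist (siblingSnd q) (betaSeq q n) by exact_mod_cast this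
  obtain ⟨a0, a1, a2⟩ := descents_ofPair (TreeVertex.base q) (sibling q) 0
    (by simp [height_sibling, height_base]) (betaSeq q n)
  change _ = descent (sibling q) (TreeVertex.base q) ∧
    _ = descent (TreeVertex.base q) (sibling q) at a1
  rw [descent_sibling.1, descent_sibling.2] at a1
  have e := descents_base_hanging (betaSeq_mem_hanging (q := q) n)
  have hb := pathBound_dist (siblingSnd q) (betaSeq q n)
  change _ = descents (base 3 q) (betaSeq q n) 2 ∧
    _ = descents (betaSeq q n) (base 3 q) 2 at a2
  change descents (siblingSnd q) (betaSeq q n) 1 = _ ∧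
    descents (betaSeq q n) (siblingSnd q) 1 = _ at a1
  change descents (siblingSnd q) (betaSeq q n) 2 = _ ∧
    descents (betaSeq q n) (siblingSnd q) 2 = _ at a2
  rw [pathBound_iff] at hb
  omega

/-- If `x` lies below `o` in the first tree, then moving to the sibling of `o` does not increase
the distance to `x`. -/
lemma descents_base_fst_eq_zero {x : DL 3 q}
    (h : (graph 3 q).dist (base 3 q) x < (graph 3 q).dist (siblingFst q) x) :
    descents (base 3 q) x 0 = 0 := by
  by_contra hpos
  have e := descent_le_of_pred_eq_pred (w := x.coord 0) pred_sibling (Nat.pos_of_ne_zero hpos)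
  refine h.not_ge (dist_le_iff.2 ((pathBound_dist (base 3 q) x).mono ?_ ?_)) <;>
  · intro i
    fin_cases i
    · first | exact e.1 | exact e.2
    · exact le_rfl
    · exact le_rfl

lemma descents_base_snd_eq_zero {x : DL 3 q}
    (h : (graph 3 q).dist (base 3 q) x < (graph 3 q).dist (siblingSnd q) x) :
    descents (base 3 q) x 1 = 0 := by
  by_contra hpos
  have e := descent_le_of_pred_eq_pred (w := x.coord 1) pred_sibling (Nat.pos_of_ne_zero hpos)
  refine h.not_ge (dist_le_iff.2 ((pathBound_dist (base 3 q) x).mono ?_ ?_)) <;>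
  · intro i
    fin_cases i
    · exact le_rfl
    · first | exact e.1 | exact e.2
    · exact le_rfl

/-- The pairs `s, t` of successors of `o` give the vertices `(s, t, o'')`, where `o''` is two
edges below `o`. -/
def succPair {s t : TreeVertex q} (hs : s.pred = TreeVertex.base q)
    (ht : t.pred = TreeVertex.base q) : DL 3 q :=
  ofPair s t 2 (by
    have h1 := s.height_pred
    have h2 := t.height_pred
    rw [hs, height_base] at h1
    rw [ht, height_base] at h2
    push_cast
    linarith)

lemma beta_succPair_le {s t : TreeVertex q} (hs : s.pred = TreeVertex.base q)
    (ht : t.pred = TreeVertex.base q) : beta q (succPair hs ht) ≤ -2 := by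
  refine (beta_ofPair_le _ ?_ ?_).trans (by simp)
  · rw [← hs]; exact (descent_iterate_pred 1 s).1
  · rw [← ht]; exact (descent_iterate_pred 1 t).1

/-- With $m_1=m_2=0$ the distance from $id$ to $x$ is $m_3+l_3$, where $m_3=l_1+l_2+l_3$. Only
orders beginning with the third tree can save $2$, and their cost from the new vertex is at least
$2m_3-2$. Hence $m_3\le l_3$, which forces $l_1=l_2=0$. -/
lemma eq_base_of_dist_succPair {x : DL 3 q} {s t : TreeVertex q}
    (hs : s.pred = TreeVertex.base q) (ht : t.pred = TreeVertex.base q)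
    (hsx : descent s (x.coord 0) = descents (base 3 q) x 0 + 1 ∧
      descent (x.coord 0) s = descents x (base 3 q) 0)
    (htx : descent t (x.coord 1) = descents (base 3 q) x 1 + 1 ∧
      descent (x.coord 1) t = descents x (base 3 q) 1)
    (h0 : descents (base 3 q) x 0 = 0) (h1 : descents (base 3 q) x 1 = 0)
    (h : (graph 3 q).dist (succPair hs ht) x + 2 ≤ (graph 3 q).dist (base 3 q) x) :
    descents x (base 3 q) 0 = 0 ∧ descents x (base 3 q) 1 = 0 := by
  obtain ⟨d, hd⟩ := Nat.exists_eq_add_of_le h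
  have hb := pathBound_dist (succPair hs ht) x
  have hn : ¬ PathBound (descents (base 3 q) x) (descents x (base 3 q))
      ((graph 3 q).dist (succPair hs ht) x + 1) := by
    rw [← dist_le_iff]
    omega
  have hsum := descents_sum (i := 0) (j := 1) (k := 2) (by decide) (by decide) (by decide)
    (base 3 q) x
  obtain ⟨a0, a1, a2⟩ : (descents (succPair hs ht) x 0 = descent s (x.coord 0) ∧
      descents x (succPair hs ht) 0 = descent (x.coord 0) s) ∧
    (descents (succPair hs ht) x 1 = descent t (x.coord 1) ∧
      descents x (succPair hs ht) 1 = descent (x.coord 1) t) ∧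
    (descents (succPair hs ht) x 2 = descent (TreeVertex.base q).pred.pred (x.coord 2) ∧
      descents x (succPair hs ht) 2 = descent (x.coord 2) (TreeVertex.base q).pred.pred) :=
    descents_ofPair s t 2 _ x
  have p1 := descent_pred (TreeVertex.base q) (x.coord 2)
  have p2 := descent_pred (TreeVertex.base q).pred (x.coord 2)
  change (descents (base 3 q) x 2 = _ ∧ _ = descents x (base 3 q) 2) ∨
    (descents (base 3 q) x 2 = _ ∧ _ ∧ _ = descents x (base 3 q) 2 + 1) at p1
  rw [pathBound_iff] at hb hn
  simp only [not_or] at hn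
  obtain ⟨n1, n2, n3, n4, n5, n6⟩ := hn
  clear h hd
  rcases hb with hb | hb | hb | hb | hb | hb <;> rcases p1 with p1 | p1 <;>
    rcases p2 with p2 | p2 <;> omega

/-- A neighbourhood of `β` which isolates it in the boundary. -/
lemma exists_isOpen_beta_mem (q : ℕ) [Fact (2 ≤ q)] : ∃ U : Set C(DL 3 q, ℝ), IsOpen U ∧
    beta q ∈ U ∧ ∀ x, horoMap (base 3 q) x ∈ U → ∃ n, x ∈ hanging q n := by
  obtain ⟨s₀, hs₀, hne⟩ := (TreeVertex.base q).exists_pred_eq_ne_succOne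
  have hs₁ := (TreeVertex.base q).pred_succOne
  have hev : ∀ z : DL 3 q, Continuous fun g : C(DL 3 q, ℝ) => g z :=
    fun z => continuous_eval_const z
  -- All four pairs of two successors of $o$ are tested, since which pair leads away from $x$
  -- depends on $x$. The strict bound $-1$ keeps the set open; for the integer-valued $f_x$ it means
  -- at most $-2$.
  refine ⟨{g | 0 < g (siblingFst q) ∧ 0 < g (siblingSnd q) ∧
    g (succPair hs₀ hs₀) < -1 ∧ g (succPair hs₀ hs₁) < -1 ∧
    g (succPair hs₁ hs₀) < -1 ∧ g (succPair hs₁ hs₁) < -1}, ?_, ?_, ?_⟩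
  · refine (isOpen_lt continuous_const (hev _)).inter ((isOpen_lt continuous_const (hev _)).inter
      ((isOpen_lt (hev _) continuous_const).inter ((isOpen_lt (hev _) continuous_const).inter
      ((isOpen_lt (hev _) continuous_const).inter (isOpen_lt (hev _) continuous_const)))))
  · have key : ∀ {s t : TreeVertex q} (hs : s.pred = TreeVertex.base q)
        (ht : t.pred = TreeVertex.base q), beta q (succPair hs ht) < -1 :=
      fun hs ht => (beta_succPair_le hs ht).trans_lt (by norm_num)
    exact ⟨beta_siblingFst_pos, beta_siblingSnd_pos, key _ _, key _ _, key _ _, key _ _⟩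
  · rintro x ⟨h1, h2, h3⟩
    have pos : ∀ z, 0 < horoMap (base 3 q) x z →
        (graph 3 q).dist (base 3 q) x < (graph 3 q).dist z x := by
      intro z hz
      change 0 < dist x z - dist x (base 3 q) at hz
      rw [dist_comm x, dist_comm x, dist_def, dist_def, sub_pos] at hz
      exact_mod_cast hz
    have neg : ∀ z, horoMap (base 3 q) x z < -1 →
        (graph 3 q).dist z x + 2 ≤ (graph 3 q).dist (base 3 q) x := by
      intro z hz
      change dist x z - dist x (base 3 q) < -1 at hz
      rw [dist_comm x, dist_comm x, dist_def, dist_def] at hz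
      have : ((graph 3 q).dist z x : ℝ) + 1 < (graph 3 q).dist (base 3 q) x := by linarith
      have : (graph 3 q).dist z x + 1 < (graph 3 q).dist (base 3 q) x := by exact_mod_cast this
      omega
    have e0 := descents_base_fst_eq_zero (pos _ h1)
    have e1 := descents_base_snd_eq_zero (pos _ h2)
    obtain ⟨e2, e3⟩ : descents x (base 3 q) 0 = 0 ∧ descents x (base 3 q) 1 = 0 := by
      rcases descent_eq_succ_of_ne hs₀ hs₁ hne (x.coord 0) with h | h <;>
      rcases descent_eq_succ_of_ne hs₀ hs₁ hne (x.coord 1) with h' | h'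
      · exact eq_base_of_dist_succPair _ _ h h' e0 e1 (neg _ h3.1)
      · exact eq_base_of_dist_succPair _ _ h h' e0 e1 (neg _ h3.2.1)
      · exact eq_base_of_dist_succPair _ _ h h' e0 e1 (neg _ h3.2.2.1)
      · exact eq_base_of_dist_succPair _ _ h h' e0 e1 (neg _ h3.2.2.2)
    exact ⟨_, mem_hanging_down (eq_of_descent_eq_zero e2 e0) (eq_of_descent_eq_zero e3 e1)⟩

lemma exists_isOpen_inter_horoBoundary (q : ℕ) [Fact (2 ≤ q)] : ∃ U : Set C(DL 3 q, ℝ),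
    IsOpen U ∧ U ∩ horoBoundary (base 3 q) = {beta q} := by
  obtain ⟨U, hU, hβ, h⟩ := exists_isOpen_beta_mem q
  refine ⟨U, hU, Subset.antisymm ?_ ?_⟩
  · rintro ξ ⟨hξU, hξ, hξr⟩
    refine ContinuousMap.ext fun z => eq_of_forall_dist_le fun ε hε => ?_
    have hfin := (finite_hanging (q := q) (threshold z)).image (horoMap (base 3 q))
    -- Removing the finitely many $f_x$ with $x$ hanging at depth below the threshold of $z$ keeps
    -- $\xi$, which is no $f_x$; each remaining $f_x$ in $U$ takes the value $\beta(z)$ at $z$.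
    have hopen : IsOpen (U ∩ (horoMap (base 3 q) ''
        {x | ∃ n < threshold z, x ∈ hanging q n})ᶜ ∩ {g | dist (g z) (ξ z) < ε}) :=
      (hU.inter hfin.isClosed.isOpen_compl).inter
        (isOpen_lt ((continuous_eval_const z).dist continuous_const)
          continuous_const)
    have hmem : ξ ∈ U ∩ (horoMap (base 3 q) ''
        {x | ∃ n < threshold z, x ∈ hanging q n})ᶜ ∩ {g | dist (g z) (ξ z) < ε} :=
      ⟨⟨hξU, fun ⟨x, _, hx⟩ => hξr ⟨x, hx⟩⟩, by simpa using hε⟩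
    obtain ⟨_, ⟨⟨hx1, hx2⟩, hx3⟩, x, rfl⟩ := mem_closure_iff.1 hξ _ hopen hmem
    obtain ⟨n, hn⟩ := h x hx1
    have hle : threshold z ≤ n := by
      by_contra! hlt
      exact hx2 ⟨x, ⟨n, hlt, hn⟩, rfl⟩
    change dist (horoMap (base 3 q) x z) (ξ z) < ε at hx3
    rw [horoMap_hanging hn hle, dist_comm] at hx3
    exact hx3.le
  · rintro _ rfl
    exact ⟨hβ, beta_mem_horoBoundary⟩

/-! ### A second point in the star -/

lemma descents_upUpDown (a b : ℕ) (w : DL 3 q) :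
    (descents (upUpDown q a b) w 0 = descent (succOne^[a] (TreeVertex.base q)) (w.coord 0) ∧
      descents w (upUpDown q a b) 0 = descent (w.coord 0) (succOne^[a] (TreeVertex.base q))) ∧
    (descents (upUpDown q a b) w 1 = descent (succOne^[b] (TreeVertex.base q)) (w.coord 1) ∧
      descents w (upUpDown q a b) 1 = descent (w.coord 1) (succOne^[b] (TreeVertex.base q))) ∧
    (descents (upUpDown q a b) w 2 = descent (pred^[a + b] (TreeVertex.base q)) (w.coord 2) ∧
      descents w (upUpDown q a b) 2 = descent (w.coord 2) (pred^[a + b] (TreeVertex.base q))) :=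
  descents_ofPair _ _ _ _ _

lemma dist_upUpDown_base (k : ℕ) : (graph 3 q).dist (upUpDown q 0 k) (base 3 q) = k := by
  have e := descents_upUpDown (q := q) 0 k (base 3 q)
  have e0 : ∀ i, (base 3 q).coord i = TreeVertex.base q := fun _ => rfl
  have e1 := descent_iterate_succOne k (TreeVertex.base q)
  have e2 := descent_iterate_pred k (TreeVertex.base q)
  have e3 := descent_self (TreeVertex.base q)
  simp only [e0, Function.iterate_zero, id_eq, zero_add] at e
  apply le_antisymm
  · rw [dist_le_iff, pathBound_iff]
    omega
  · have h := pathBound_dist (upUpDown q 0 k) (base 3 q)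
    rw [pathBound_iff] at h
    omega

lemma dist_upUpDown_betaSeq_le (k : ℕ) :
    (graph 3 q).dist (upUpDown q 0 k) (betaSeq q k) ≤ k := by
  have e := descents_upUpDown (q := q) 0 k (betaSeq q k)
  have e0 : (betaSeq q k).coord 0 = TreeVertex.base q := rfl
  have e0' : (betaSeq q k).coord 1 = TreeVertex.base q := rfl
  have e1 := descent_iterate_succOne k (TreeVertex.base q)
  -- The third coordinate of `upUpDown q 0 k` is exactly the common ancestor of $o$ and the third
  -- coordinate of $\beta_k$.
  have hpred : pred^[k] (TreeVertex.base q) = pred^[k] ((betaSeq q k).coord 2) := by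
    have h := iterate_pred_length ((betaSeq q k).coord 2)
    rw [length_up_of_mem_hanging (betaSeq_mem_hanging k)] at h
    rw [h, iterate_pred_base]
    rfl
  have e2 := descent_iterate_pred k ((betaSeq q k).coord 2)
  have e3 := descent_self (TreeVertex.base q)
  simp only [e0, e0', Function.iterate_zero, id_eq, zero_add, hpred] at e
  rw [dist_le_iff, pathBound_iff]
  omega

lemma dist_upUpDown_succ_le (k : ℕ) :
    (graph 3 q).dist (upUpDown q 0 (k + 1)) (upUpDown q 0 k) ≤ 1 := by
  have e := descents_upUpDown (q := q) 0 (k + 1) (upUpDown q 0 k)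
  have e0 : (upUpDown q 0 k).coord 0 = TreeVertex.base q := rfl
  have e0' : (upUpDown q 0 k).coord 1 = succOne^[k] (TreeVertex.base q) := rfl
  have e0'' : (upUpDown q 0 k).coord 2 = pred^[0 + k] (TreeVertex.base q) := rfl
  have e1 := descent_iterate_succOne 1 (succOne^[k] (TreeVertex.base q))
  have e2 := descent_iterate_pred 1 (pred^[k] (TreeVertex.base q))
  have e3 := descent_self (TreeVertex.base q)
  rw [← Function.iterate_add_apply, add_comm 1 k] at e1 e2
  simp only [e0, e0', e0'', Function.iterate_zero, id_eq, zero_add] at e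
  rw [dist_le_iff, pathBound_iff]
  omega

/-- Every order costs at least $m_1+m_2+m_3$, and here $m_2=k$. -/
lemma le_dist_upUpDown_one (k : ℕ) :
    k ≤ (graph 3 q).dist (upUpDown q 0 k) (upUpDown q 1 0) := by
  have e := descents_upUpDown (q := q) 0 k (upUpDown q 1 0)
  have e0 : (upUpDown q 1 0).coord 1 = TreeVertex.base q := rfl
  have e1 := descent_iterate_succOne k (TreeVertex.base q)
  have h := pathBound_dist (upUpDown q 0 k) (upUpDown q 1 0)
  simp only [e0] at e
  rw [pathBound_iff] at h
  omega

/-- Consecutive vertices are at distance at most $1$ while the distance to $id$ grows by exactly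
$1$, so at each point the values decrease; the triangle inequality bounds them below. -/
lemma exists_tendsto_horoMap_upUpDown (q : ℕ) [Fact (2 ≤ q)] : ∃ ξ : C(DL 3 q, ℝ),
    Tendsto (fun k => horoMap (base 3 q) (upUpDown q 0 k)) atTop (𝓝 ξ) := by
  refine ⟨⟨fun w => ⨅ k, horoMap (base 3 q) (upUpDown q 0 k) w,
    continuous_of_discreteTopology⟩, tendsto_of_forall_apply fun w => ?_⟩
  refine tendsto_atTop_ciInf (antitone_nat_of_succ_le fun k => ?_) ⟨-dist (base 3 q) w, ?_⟩
  · change dist (upUpDown q 0 (k + 1)) w - dist (upUpDown q 0 (k + 1)) (base 3 q) ≤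
      dist (upUpDown q 0 k) w - dist (upUpDown q 0 k) (base 3 q)
    have h1 := dist_triangle (upUpDown q 0 (k + 1)) (upUpDown q 0 k) w
    have h2 : dist (upUpDown q 0 (k + 1)) (upUpDown q 0 k) ≤ 1 := by
      rw [dist_def]; exact_mod_cast dist_upUpDown_succ_le k
    rw [dist_def _ (base 3 q), dist_def _ (base 3 q), dist_upUpDown_base, dist_upUpDown_base]
    push_cast
    linarith
  · rintro _ ⟨k, rfl⟩
    change _ ≤ dist (upUpDown q 0 k) w - dist (upUpDown q 0 k) (base 3 q)
    have h := dist_triangle (upUpDown q 0 k) w (base 3 q)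
    rw [dist_comm w] at h
    linarith

lemma horoStar_beta_ne : horoStar (base 3 q) (beta q) ≠ {beta q} := by
  obtain ⟨ξ, hξ⟩ := exists_tendsto_horoMap_upUpDown q
  have hmem : ξ ∈ horoStar (base 3 q) (beta q) := by
    -- $C=0$ suffices: a neighbourhood of $\beta$ contains $\beta_k$ for large $k$, and the $k$-th
    -- vertex is no farther from $\beta_k$ than from $id$.
    refine subset_closure (mem_iUnion₂.2 ⟨0, le_rfl, mem_iInter₂.2 fun U hU => ?_⟩)
    refine mem_closure_of_tendsto hξ ?_
    filter_upwards [tendsto_horoMap_betaSeq.eventually hU] with k hk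
    refine mem_image_of_mem _ ?_
    refine (Metric.infEDist_le_edist_of_mem (y := betaSeq q k) hk).trans ?_
    rw [edist_dist]
    refine ENNReal.ofReal_le_ofReal ?_
    rw [add_zero, dist_def, dist_def, dist_upUpDown_base]
    exact_mod_cast dist_upUpDown_betaSeq_le k
  intro h
  rw [h, mem_singleton_iff] at hmem
  -- The point one edge up in the first tree and one down in the third separates the two: $\beta\le
  -- -1$ there, but $\xi\ge 0$.
  have h1 : beta q (upUpDown q 1 0) ≤ -((1 + 0 : ℕ) : ℝ) :=
    beta_ofPair_le _ (descent_iterate_succOne _ _).1 (descent_iterate_succOne _ _).1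
  have h2 : 0 ≤ ξ (upUpDown q 1 0) := by
    refine ge_of_tendsto' (((continuous_eval_const _).tendsto ξ).comp hξ)
      fun k => ?_
    change 0 ≤ dist (upUpDown q 0 k) (upUpDown q 1 0) - dist (upUpDown q 0 k) (base 3 q)
    rw [dist_def, dist_def, dist_upUpDown_base, sub_nonneg]
    exact_mod_cast le_dist_upUpDown_one k
  rw [hmem] at h2
  norm_num at h1
  linarith

end DL

theorem mainTheorem6 (q : ℕ) [Fact (2 ≤ q)] :
    ∃ β : C(DL 3 q, ℝ),
      IsHorofunctionOf (DL.base 3 q) (DL.betaSeq q) β ∧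
      β ∈ horoBoundary (DL.base 3 q) ∧
      (∃ U : Set C(DL 3 q, ℝ), IsOpen U ∧ U ∩ horoBoundary (DL.base 3 q) = {β}) ∧
      horoStar (DL.base 3 q) β ≠ {β} :=
  ⟨DL.beta q, DL.isHorofunctionOf_beta, DL.beta_mem_horoBoundary,
    DL.exists_isOpen_inter_horoBoundary q, DL.horoStar_beta_ne⟩
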